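/- **Conventions.** Let $k\ge 1$. A $k$-graph is a small category $\Lambda$ (object set $\Lambda^{\mathrm{ob}}$, source $s$, range $r$) with a functor $d:\Lambda\to\mathbb N^k$ such that whenever $d(\lambda)=m+n$ there are unique $\mu,\nu\in\Lambda$ with $d(\mu)=m$, $d(\nu)=n$ and $\lambda=\mu\circ\nu$. All $k$-graphs are assumed to be nonempty, connected, row-finite ($v\Lambda^n=\{\lambda: r(\lambda)=v,\ d(\lambda)=n\}$ is finite for all $v,n$) and without sources (each $v\Lambda^n$ is nonempty). Morphisms of $k$-graphs are degree-preserving functors. Write $\Lambda v=s^{-1}(v)$ and $v\Lambda=r^{-1}(v)$. A walk in $\Lambda$ is a nonempty finite path in the directed graph whose vertices are the objects and whose edges are the morphisms of $\Lambda$ together with a reversed edge $\lambda^*$ for each non-identity morphism $\lambda$; $\mathrm{Walk}_u(\Lambda)$ is the set of walks starting in $u$. A $k$-graph morphism $\alpha$ acts on walks by $\lambda\mapsto\alpha(\lambda)$, $\lambda^*\mapsto\alpha(\lambda)^*$. A covering of $\Lambda$ is a $k$-graph $\Omega$ with a $k$-graph morphism $\tau:\Omega\to\Lambda$ that maps $\Omega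 v$ bijectively onto $\Lambda\tau(v)$ and $v\Omega$ bijectively onto $\tau(v)\Lambda$ for every vertex $v$ of $\Omega$. It is universal if for every covering $(\Sigma,\beta)$ of $\Lambda$ there is a $k$-graph morphism $\phi:\Omega\to\Sigma$ with $\beta\circ\phi=\tau$. A representation $k$-graph for $\Lambda$ is a $k$-graph $\Delta$ with a $k$-graph morphism $\alpha:\Delta\to\Lambda$ such that, for every $v\in\Delta^{\mathrm{ob}}$, $\alpha$ maps $\Delta v$ bijectively onto $\Lambda\alpha(v)$, and $v\Delta^n$ is a singleton for every $n\in\mathbb N^k$. A morphism $(\Delta,\alpha)\to(\Sigma,\beta)$ is a $k$-graph morphism $\phi:\Delta\to\Sigma$ with $\beta\circ\phi=\alpha$. This defines the category $\mathrm{RG}(\Lambda)$. Call $(\Delta,\alpha)$ irreducible if $\alpha(\mathrm{Walk}_u(\Delta))\ne\alpha(\mathrm{Walk}_v(\Delta))$ for all vertices $u\neq v$ of $\Delta$. Write $u\sim v$ if $\alpha(\mathrm{Walk}_u(\Delta))=\alpha(\mathrm{Walk}_v(\Delta))$. The quotient $(\Delta_\sim,\alpha_\sim)$ is the representation $k$-graph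 for $\Lambda$ with vertices the classes $[v]$ of $\sim$ and morphisms the classes $[\delta]$ of the relation "$s(\delta)\sim s(\delta')$ and $\alpha(\delta)=\alpha(\delta')$", with $s[\delta]=[s(\delta)]$, $r[\delta]=[r(\delta)]$, $d[\delta]=d(\delta)$, $[\delta]\circ[\delta']=[\delta\circ\delta']$ for composable $\delta,\delta'$, identities $1_{[v]}=[1_v]$, $\alpha_\sim[v]=\alpha(v)$ and $\alpha_\sim[\delta]=\alpha(\delta)$. **Statement.** Let $\Lambda$ be a $k$-graph and let $C$ be a connected component of $\mathrm{RG}(\Lambda)$. For every object $(\Delta,\alpha)$ of $C$ the $k$-graph $\Delta$ has a universal covering. Moreover, for every object $(\Delta,\alpha)$ of $C$ and every universal covering $(\Omega,\tau)$ of $\Delta$, put $$(\Omega_C,\zeta_C)=(\Omega,\alpha\circ\tau),\qquad (\Gamma_C,\xi_C)=((\Omega_C)_\sim,(\zeta_C)_\sim).$$ Then $(\Gamma_C,\xi_C)$ is an object of $C$, it is irreducible, and every irreducible representation $k$-graph in $C$ is isomorphic to $(\Gamma_C,\xi_C)$ in $\mathrm{RG}(\Lambda)$. -/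

import Mathlib

open CategoryTheory

universe u

namespace RepKG

/-! ### Morphisms of a small category, as a single set -/

/-- The set of all morphisms of a category; `s` is the source and `r` the range. -/
structure Mor (C : Type u) [SmallCategory C] : Type u where
  s : C
  r : C
  hom : s ⟶ r

namespace Mor

variable {C D : Type u} [SmallCategory C] [SmallCategory D]

/-- A single morphism, regarded as an element of the set of all morphisms. -/
def of {a b : C} (f : a ⟶ b) : Mor C := ⟨a, b, f⟩

/-- `x` is an identity morphism. -/
def IsId (x : Mor C) : Prop := ∃ v : C, x = Mor.of (𝟙 v)

/-- The action of a functor on the set of all morphisms. -/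
def map (F : C ⥤ D) (x : Mor C) : Mor D := ⟨F.obj x.s, F.obj x.r, F.map x.hom⟩

theorem of_inj {a b : C} {f g : a ⟶ b} (h : Mor.of f = Mor.of g) : f = g := by
  simpa [Mor.of] using h

theorem comp_congr {a b c a' b' c' : C} {f : a ⟶ b} {g : b ⟶ c} {f' : a' ⟶ b'} {g' : b' ⟶ c'}
    (h₁ : Mor.of f = Mor.of f') (h₂ : Mor.of g = Mor.of g') :
    Mor.of (f ≫ g) = Mor.of (f' ≫ g') := by
  obtain rfl : a = a' := congrArg Mor.s h₁
  obtain rfl : b = b' := congrArg Mor.r h₁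
  obtain rfl : c = c' := congrArg Mor.r h₂
  obtain rfl := of_inj h₁
  obtain rfl := of_inj h₂
  rfl

/-- The morphism `x` with its source and range renamed along equalities. -/
def cast (x : Mor C) {a b : C} (hs : x.s = a) (hr : x.r = b) : a ⟶ b :=
  eqToHom hs.symm ≫ x.hom ≫ eqToHom hr

theorem of_cast (x : Mor C) {a b : C} (hs : x.s = a) (hr : x.r = b) :
    Mor.of (x.cast hs hr) = x := by
  subst hs hr
  simp [cast, Mor.of]

end Mor

/-! ### `k`-graphs -/

/-- A `k`-graph: a small category with a degree functor to `ℕ^k` that satisfies the factorisation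
property. The standing assumptions are included: the category is nonempty and connected, it is
row-finite and has no sources. (`f ≫ g` is the composite `g ∘ f`.) -/
structure KGraph (k : ℕ) : Type (u + 1) where
  Ob : Type u
  [cat : SmallCategory Ob]
  deg : ∀ {a b : Ob}, (a ⟶ b) → (Fin k → ℕ)
  deg_id : ∀ a : Ob, deg (𝟙 a) = 0
  deg_comp : ∀ {a b c : Ob} (f : a ⟶ b) (g : b ⟶ c), deg (f ≫ g) = deg g + deg f
  factorisation : ∀ {a c : Ob} (f : a ⟶ c) (m n : Fin k → ℕ), deg f = m + n →
    ∃! t : Σ b : Ob, (a ⟶ b) × (b ⟶ c),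
      deg t.2.2 = m ∧ deg t.2.1 = n ∧ t.2.1 ≫ t.2.2 = f
  connected : IsConnected Ob
  rowFinite : ∀ (v : Ob) (n : Fin k → ℕ), {x : Mor Ob | x.r = v ∧ deg x.hom = n}.Finite
  noSources : ∀ (v : Ob) (n : Fin k → ℕ), {x : Mor Ob | x.r = v ∧ deg x.hom = n}.Nonempty

attribute [instance] KGraph.cat KGraph.connected

namespace KGraph

variable {k : ℕ}

/-- The set of all paths (morphisms) of a `k`-graph. -/
abbrev Path (Λ : KGraph.{u} k) : Type u := Mor Λ.Ob

/-- The degree map on the set of all paths. -/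
def d (Λ : KGraph.{u} k) (x : Λ.Path) : Fin k → ℕ := Λ.deg x.hom

/-- `Λ v`, the set of paths with source `v`. -/
def pathsFrom (Λ : KGraph.{u} k) (v : Λ.Ob) : Set Λ.Path := {x | x.s = v}

/-- `v Λ`, the set of paths with range `v`. -/
def pathsTo (Λ : KGraph.{u} k) (v : Λ.Ob) : Set Λ.Path := {x | x.r = v}

/-- `v Λ^n`, the set of paths with range `v` and degree `n`. -/
def pathsToDeg (Λ : KGraph.{u} k) (v : Λ.Ob) (n : Fin k → ℕ) : Set Λ.Path :=
  {x | x.r = v ∧ Λ.d x = n}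

theorem d_isId (Λ : KGraph.{u} k) {x : Λ.Path} (h : x.IsId) : Λ.d x = 0 := by
  obtain ⟨v, rfl⟩ := h
  exact Λ.deg_id v

/-- Paths of degree zero are identities. -/
theorem isId_of_d_eq_zero (Λ : KGraph.{u} k) {x : Λ.Path} (h : Λ.d x = 0) : x.IsId := by
  obtain ⟨a, b, f⟩ := x
  have h : Λ.deg f = 0 := h
  obtain ⟨t, -, ht⟩ := Λ.factorisation f 0 0 (by simpa using h)
  have h₁ := ht ⟨a, 𝟙 a, f⟩ ⟨h, Λ.deg_id a, Category.id_comp f⟩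
  have h₂ := ht ⟨b, f, 𝟙 b⟩ ⟨Λ.deg_id b, h, Category.comp_id f⟩
  have h₃ := h₁.trans h₂.symm
  obtain rfl : a = b := congrArg Sigma.fst h₃
  simp only [Sigma.mk.injEq, heq_eq_eq, Prod.mk.injEq, true_and] at h₃
  exact ⟨a, by rw [h₃.2]; rfl⟩

end KGraph

/-- A morphism of `k`-graphs: a degree-preserving functor. -/
@[ext]
structure KHom {k : ℕ} (Δ Λ : KGraph.{u} k) : Type u where
  functor : Δ.Ob ⥤ Λ.Ob
  deg_map : ∀ {a b : Δ.Ob} (f : a ⟶ b), Λ.deg (functor.map f) = Δ.deg f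

namespace KHom

variable {k : ℕ}

/-- The action of a `k`-graph morphism on vertices. -/
def onOb {Δ Λ : KGraph.{u} k} (α : KHom Δ Λ) (v : Δ.Ob) : Λ.Ob := α.functor.obj v

/-- The action of a `k`-graph morphism on paths. -/
def onPath {Δ Λ : KGraph.{u} k} (α : KHom Δ Λ) (x : Δ.Path) : Λ.Path := x.map α.functor

/-- The identity morphism. -/
def id (Λ : KGraph.{u} k) : KHom Λ Λ := ⟨𝟭 _, fun _ => rfl⟩

/-- `φ.comp α` is the composite `α ∘ φ`. -/
def comp {Δ Δ' Λ : KGraph.{u} k} (φ : KHom Δ Δ') (α : KHom Δ' Λ) : KHom Δ Λ where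
  functor := φ.functor ⋙ α.functor
  deg_map f := by simp [α.deg_map, φ.deg_map]

variable {Δ Λ : KGraph.{u} k} (α : KHom Δ Λ)

theorem onPath_of {a b : Δ.Ob} (f : a ⟶ b) :
    α.onPath (Mor.of f) = Mor.of (α.functor.map f) := rfl

theorem d_onPath (x : Δ.Path) : Λ.d (α.onPath x) = Δ.d x := α.deg_map x.hom

theorem not_isId_onPath {x : Δ.Path} (hx : ¬ x.IsId) : ¬ (α.onPath x).IsId := fun h =>
  hx (Δ.isId_of_d_eq_zero (by rw [← α.d_onPath, Λ.d_isId h]))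

end KHom

/-! ### Walks -/

/-- An edge of the graph obtained from the underlying graph of the category `C` by adding an edge
`x^*` with reversed direction for every morphism `x` that is not an identity. -/
inductive WalkEdge (C : Type u) [SmallCategory C] : Type u
  | fwd (x : Mor C) : WalkEdge C
  | bwd (x : Mor C) (hx : ¬ x.IsId) : WalkEdge C

namespace WalkEdge

variable {C : Type u} [SmallCategory C]

/-- The source of an edge. -/
def s : WalkEdge C → C
  | fwd x => x.s
  | bwd x _ => x.r

/-- The range of an edge. -/
def r : WalkEdge C → C
  | fwd x => x.r
  | bwd x _ => x.s

/-- The action of a `k`-graph morphism on edges: `x` goes to `α(x)` and `x^*` to `α(x)^*`. -/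
def map {k : ℕ} {Δ Λ : KGraph.{u} k} (α : KHom Δ Λ) : WalkEdge Δ.Ob → WalkEdge Λ.Ob
  | fwd x => fwd (α.onPath x)
  | bwd x hx => bwd (α.onPath x) (α.not_isId_onPath hx)

theorem s_map {k : ℕ} {Δ Λ : KGraph.{u} k} (α : KHom Δ Λ) (e : WalkEdge Δ.Ob) :
    (e.map α).s = α.onOb e.s := by cases e <;> rfl

theorem r_map {k : ℕ} {Δ Λ : KGraph.{u} k} (α : KHom Δ Λ) (e : WalkEdge Δ.Ob) :
    (e.map α).r = α.onOb e.r := by cases e <;> rfl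

end WalkEdge

/-- A walk in `C`: a nonempty finite sequence of edges, each starting where the previous one ends.
The edges are listed in the order in which they are traversed. -/
@[ext]
structure Walk (C : Type u) [SmallCategory C] : Type u where
  edges : List (WalkEdge C)
  ne_nil : edges ≠ []
  chain : edges.IsChain (fun e e' => e.r = e'.s)

namespace Walk

variable {C : Type u} [SmallCategory C]

/-- The source of a walk, i.e. the source of its first edge. -/
def s (p : Walk C) : C := (p.edges.head p.ne_nil).s

/-- The range of a walk, i.e. the range of its last edge. -/
def r (p : Walk C) : C := (p.edges.getLast p.ne_nil).r

/-- The map on walks induced by a `k`-graph morphism. -/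
def map {k : ℕ} {Δ Λ : KGraph.{u} k} (α : KHom Δ Λ) (p : Walk Δ.Ob) : Walk Λ.Ob where
  edges := p.edges.map (WalkEdge.map α)
  ne_nil := by simpa using p.ne_nil
  chain := by
    rw [List.isChain_map]
    exact p.chain.imp fun e e' h => by rw [WalkEdge.r_map, WalkEdge.s_map, h]

/-- The walk that consists of one edge. -/
def single (e : WalkEdge C) : Walk C := ⟨[e], by simp, by simp⟩

/-- The walk `p` followed by the walk `q`. -/
def append (p q : Walk C) (h : p.r = q.s) : Walk C where
  edges := p.edges ++ q.edges
  ne_nil := by simp [p.ne_nil]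
  chain := by
    rw [List.isChain_append]
    refine ⟨p.chain, q.chain, fun x hx y hy => ?_⟩
    rw [List.getLast?_eq_getLast_of_ne_nil p.ne_nil, Option.mem_some_iff] at hx
    rw [List.head?_eq_some_head q.ne_nil, Option.mem_some_iff] at hy
    subst hx hy
    exact h

theorem s_append (p q : Walk C) (h : p.r = q.s) : (p.append q h).s = p.s := by
  simp [s, append, List.head_append_of_ne_nil p.ne_nil]

theorem r_append (p q : Walk C) (h : p.r = q.s) : (p.append q h).r = q.r := by
  simp [r, append, List.getLast_append_of_ne_nil _ q.ne_nil]

theorem s_map {k : ℕ} {Δ Λ : KGraph.{u} k} (α : KHom Δ Λ) (p : Walk Δ.Ob) :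
    (p.map α).s = α.onOb p.s := by
  simp [s, map, WalkEdge.s_map]

theorem r_map {k : ℕ} {Δ Λ : KGraph.{u} k} (α : KHom Δ Λ) (p : Walk Δ.Ob) :
    (p.map α).r = α.onOb p.r := by
  simp [r, map, WalkEdge.r_map]

end Walk

/-- `Walk_v(C)`, the set of all walks that start in `v`. -/
def walksFrom {C : Type u} [SmallCategory C] (v : C) : Set (Walk C) := {p | p.s = v}

/-! ### Coverings -/

/-- A covering of the `k`-graph `Λ`. -/
structure Covering {k : ℕ} (Λ : KGraph.{u} k) : Type (u + 1) where
  graph : KGraph.{u} k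
  hom : KHom graph Λ
  bijOn_from : ∀ v : graph.Ob,
    Set.BijOn hom.onPath (graph.pathsFrom v) (Λ.pathsFrom (hom.onOb v))
  bijOn_to : ∀ v : graph.Ob,
    Set.BijOn hom.onPath (graph.pathsTo v) (Λ.pathsTo (hom.onOb v))

/-- A covering is universal if it admits a morphism of coverings to every covering. -/
def Covering.IsUniversal {k : ℕ} {Λ : KGraph.{u} k} (T : Covering Λ) : Prop :=
  ∀ T' : Covering Λ, ∃ φ : KHom T.graph T'.graph, φ.comp T'.hom = T.hom

/-! ### Representation `k`-graphs -/

/-- A representation `k`-graph for `Λ`. -/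
structure RG {k : ℕ} (Λ : KGraph.{u} k) : Type (u + 1) where
  graph : KGraph.{u} k
  hom : KHom graph Λ
  bijOn_from : ∀ v : graph.Ob,
    Set.BijOn hom.onPath (graph.pathsFrom v) (Λ.pathsFrom (hom.onOb v))
  existsUnique_to : ∀ (v : graph.Ob) (n : Fin k → ℕ), ∃! x : graph.Path, x ∈ graph.pathsToDeg v n

namespace RG

variable {k : ℕ} {Λ : KGraph.{u} k}

/-- A morphism of representation `k`-graphs: a `k`-graph morphism over `Λ`. -/
@[ext]
structure Hom (X Y : RG Λ) : Type u where
  hom : KHom X.graph Y.graph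
  comm : hom.comp Y.hom = X.hom

/-- The category of representation `k`-graphs for `Λ`. -/
instance : Category (RG Λ) where
  Hom X Y := Hom X Y
  id X := ⟨KHom.id X.graph, rfl⟩
  comp f g := ⟨f.hom.comp g.hom, by
    have h₁ := f.comm
    have h₂ := g.comm
    rw [← h₁, ← h₂]
    rfl⟩

/-- `α(Walk_v(Δ))`, a set of walks in `Λ`. -/
def walkImage (X : RG Λ) (v : X.graph.Ob) : Set (Walk Λ.Ob) :=
  Walk.map X.hom '' walksFrom v

/-- Irreducibility: distinct vertices have distinct sets of (images of) walks. -/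
def Irreducible (X : RG Λ) : Prop :=
  ∀ v w : X.graph.Ob, v ≠ w → X.walkImage v ≠ X.walkImage w

/-- The equivalence relation `∼` on the vertices. -/
def sim (X : RG Λ) : Setoid X.graph.Ob where
  r v w := X.walkImage v = X.walkImage w
  iseqv := ⟨fun _ => rfl, fun h => h.symm, fun h h' => h.trans h'⟩

/-- Admissible equivalence relations on the vertices. -/
structure IsAdmissible (X : RG Λ) (E : Setoid X.graph.Ob) : Prop where
  le_sim : ∀ v w, E v w → X.sim v w
  range_rel : ∀ p q : Walk X.graph.Ob, E p.s q.s → p.map X.hom = q.map X.hom → E p.r q.r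

theorem edge_ext (X : RG Λ) {e e' : WalkEdge X.graph.Ob} (hs : e.s = e'.s)
    (h : e.map X.hom = e'.map X.hom) : e = e' := by
  cases e with
  | fwd x =>
    cases e' with
    | fwd y =>
      have h' : X.hom.onPath x = X.hom.onPath y := by simpa [WalkEdge.map] using h
      rw [(X.bijOn_from y.s).injOn hs rfl h']
    | bwd y hy => simp [WalkEdge.map] at h
  | bwd x hx =>
    cases e' with
    | fwd y => simp [WalkEdge.map] at h
    | bwd y hy =>
      have h' : X.hom.onPath x = X.hom.onPath y := by simpa [WalkEdge.map] using h
      have hd : X.graph.d x = X.graph.d y := by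
        rw [← X.hom.d_onPath, ← X.hom.d_onPath, h']
      have : x = y := (X.existsUnique_to y.r (X.graph.d y)).unique ⟨hs, hd⟩ ⟨rfl, rfl⟩
      subst this
      rfl

theorem edges_ext (X : RG Λ) : ∀ (l l' : List (WalkEdge X.graph.Ob)) (hl : l ≠ []) (hl' : l' ≠ []),
    l.IsChain (fun e e' => e.r = e'.s) → l'.IsChain (fun e e' => e.r = e'.s) →
    (l.head hl).s = (l'.head hl').s →
    l.map (WalkEdge.map X.hom) = l'.map (WalkEdge.map X.hom) → l = l'
  | [], _, hl, _, _, _, _, _ => absurd rfl hl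
  | _ :: _, [], _, hl', _, _, _, _ => absurd rfl hl'
  | [e], [e'], _, _, _, _, hs, h => by
    simp only [List.map_cons, List.map_nil, List.cons.injEq, and_true] at h
    exact congrArg (fun a => [a]) (X.edge_ext hs h)
  | [e], e' :: e₂' :: l', _, _, _, _, _, h => by simp at h
  | e :: e₂ :: l, [e'], _, _, _, _, _, h => by simp at h
  | e :: e₂ :: l, e' :: e₂' :: l', _, _, hc, hc', hs, h => by
    rw [List.map_cons, List.map_cons (l := e₂' :: l'), List.cons.injEq] at h
    rw [List.isChain_cons_cons] at hc hc'
    have he := X.edge_ext hs h.1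
    have he : e = e' := he
    have hl := X.edges_ext (e₂ :: l) (e₂' :: l') (by simp) (by simp) hc.2 hc'.2
      (hc.1.symm.trans ((congrArg WalkEdge.r he).trans hc'.1)) h.2
    exact congrArg₂ List.cons he hl

/-- Two walks with the same source and the same image are equal. -/
theorem walk_ext (X : RG Λ) {p q : Walk X.graph.Ob} (hs : p.s = q.s)
    (h : p.map X.hom = q.map X.hom) : p = q :=
  Walk.ext (X.edges_ext _ _ p.ne_nil q.ne_nil p.chain q.chain hs (congrArg Walk.edges h))

theorem walkImage_range_subset (X : RG Λ) {p q : Walk X.graph.Ob}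
    (hs : X.walkImage p.s = X.walkImage q.s) (h : p.map X.hom = q.map X.hom) :
    X.walkImage p.r ⊆ X.walkImage q.r := by
  rintro _ ⟨w, hw, rfl⟩
  have hw : w.s = p.r := hw
  have h₁ : (p.append w hw.symm).map X.hom ∈ X.walkImage q.s := by
    rw [← hs]
    exact ⟨_, Walk.s_append _ _ _, rfl⟩
  obtain ⟨z, hz, hz'⟩ := h₁
  have hz : z.s = q.s := hz
  have he : z.edges.map (WalkEdge.map X.hom) =
      p.edges.map (WalkEdge.map X.hom) ++ w.edges.map (WalkEdge.map X.hom) := by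
    have := congrArg Walk.edges hz'
    simpa [Walk.map, Walk.append] using this
  obtain ⟨l₁, l₂, hl, h₁, h₂⟩ := List.map_eq_append_iff.1 he
  have hl₁ : l₁ ≠ [] := by
    rintro rfl
    exact p.ne_nil (by simpa using h₁.symm)
  have hl₂ : l₂ ≠ [] := by
    rintro rfl
    exact w.ne_nil (by simpa using h₂.symm)
  have hc := z.chain
  rw [hl, List.isChain_append] at hc
  have hq : (⟨l₁, hl₁, hc.1⟩ : Walk X.graph.Ob) = q := by
    apply X.walk_ext
    · rw [← hz]
      simp [Walk.s, hl, List.head_append_of_ne_nil hl₁]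
    · rw [← h]
      exact Walk.ext h₁
  refine ⟨⟨l₂, hl₂, hc.2.1⟩, ?_, Walk.ext h₂⟩
  have := hc.2.2 (l₁.getLast hl₁) (by simp [List.getLast?_eq_getLast_of_ne_nil hl₁])
    (l₂.head hl₂) (by simp [List.head?_eq_some_head hl₂])
  rw [← hq]
  exact this.symm

/-- The relation `∼` is admissible. -/
theorem sim_isAdmissible (X : RG Λ) : X.IsAdmissible X.sim where
  le_sim _ _ h := h
  range_rel _ _ hs h := Set.Subset.antisymm (X.walkImage_range_subset hs h)
    (X.walkImage_range_subset (Eq.symm hs) h.symm)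

/-- If `(Ω, τ)` is a covering of `Δ`, then `(Ω, α ∘ τ)` is a representation `k`-graph for `Λ`. -/
def ofCovering (X : RG Λ) (T : Covering X.graph) : RG Λ where
  graph := T.graph
  hom := T.hom.comp X.hom
  bijOn_from v := (X.bijOn_from (T.hom.onOb v)).comp (T.bijOn_from v)
  existsUnique_to v n := by
    obtain ⟨x, hx, hu⟩ := X.existsUnique_to (T.hom.onOb v) n
    obtain ⟨y, hy, rfl⟩ := (T.bijOn_to v).surjOn hx.1
    refine ⟨y, ⟨hy, by rw [← T.hom.d_onPath]; exact hx.2⟩, fun z hz => ?_⟩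
    refine (T.bijOn_to v).injOn hz.1 hy (hu _ ⟨(T.bijOn_to v).mapsTo hz.1, ?_⟩)
    rw [T.hom.d_onPath]
    exact hz.2

/-! ### Quotients of representation `k`-graphs -/

section Quotient

variable {X : RG Λ} {E : Setoid X.graph.Ob}

theorem IsAdmissible.r_rel (hE : X.IsAdmissible E) {x y : X.graph.Path} (hs : E x.s y.s)
    (h : X.hom.onPath x = X.hom.onPath y) : E x.r y.r :=
  hE.range_rel (Walk.single (.fwd x)) (Walk.single (.fwd y)) hs
    (Walk.ext (by simp [Walk.map, Walk.single, WalkEdge.map, h]))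

theorem IsAdmissible.onOb_eq (hE : X.IsAdmissible E) {v w : X.graph.Ob} (h : E v w) :
    X.hom.onOb v = X.hom.onOb w := by
  have h₁ : (Walk.single (.fwd (Mor.of (𝟙 v)))).map X.hom ∈ X.walkImage v := ⟨_, rfl, rfl⟩
  have h₂ : X.walkImage v = X.walkImage w := hE.le_sim v w h
  rw [h₂] at h₁
  obtain ⟨q, hq, hq'⟩ := h₁
  have h₃ := congrArg Walk.s hq'
  rw [Walk.s_map, Walk.s_map] at h₃
  have hq : q.s = w := hq
  rw [hq] at h₃
  exact h₃.symm

theorem IsAdmissible.exists_lift (hE : X.IsAdmissible E) (x : X.graph.Path) {v : X.graph.Ob}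
    (h : E x.s v) : ∃ y : X.graph.Path, y.s = v ∧ X.hom.onPath y = X.hom.onPath x := by
  have : X.hom.onPath x ∈ Λ.pathsFrom (X.hom.onOb v) := hE.onOb_eq h
  exact (X.bijOn_from v).surjOn this

/-- The equivalence relation on paths: `x ≈ y` if `s(x) ≈ s(y)` and `α(x) = α(y)`. -/
def pathSetoid (X : RG Λ) (E : Setoid X.graph.Ob) : Setoid X.graph.Path where
  r x y := E x.s y.s ∧ X.hom.onPath x = X.hom.onPath y
  iseqv := ⟨fun _ => ⟨E.refl _, rfl⟩, fun h => ⟨E.symm h.1, h.2.symm⟩,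
    fun h h' => ⟨E.trans h.1 h'.1, h.2.trans h'.2⟩⟩

/-- The set of vertices of the quotient. -/
def QOb (_ : X.IsAdmissible E) : Type u := Quotient E

/-- The set of paths of the quotient. -/
def QPath (_ : X.IsAdmissible E) : Type u := Quotient (X.pathSetoid E)

variable (hE : X.IsAdmissible E)

/-- The class of a vertex. -/
def qOb (v : X.graph.Ob) : QOb hE := Quotient.mk E v

/-- The class of a path. -/
def qPath (x : X.graph.Path) : QPath hE := Quotient.mk (X.pathSetoid E) x

theorem qOb_eq {v w : X.graph.Ob} : qOb hE v = qOb hE w ↔ E v w := Quotient.eq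

theorem qPath_eq {x y : X.graph.Path} :
    qPath hE x = qPath hE y ↔ E x.s y.s ∧ X.hom.onPath x = X.hom.onPath y := Quotient.eq

/-- The source map of the quotient. -/
def qs : QPath hE → QOb hE :=
  Quotient.lift (fun x => qOb hE x.s) fun _ _ h => (qOb_eq hE).2 h.1

/-- The range map of the quotient. -/
def qr : QPath hE → QOb hE :=
  Quotient.lift (fun x => qOb hE x.r) fun _ _ h => (qOb_eq hE).2 (hE.r_rel h.1 h.2)

/-- The degree map of the quotient. -/
def qd : QPath hE → (Fin k → ℕ) :=
  Quotient.lift X.graph.d fun _ _ h => by rw [← X.hom.d_onPath, h.2, X.hom.d_onPath]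

/-- The map to `Λ` on the vertices of the quotient. -/
def qMapOb : QOb hE → Λ.Ob :=
  Quotient.lift X.hom.onOb fun _ _ h => hE.onOb_eq h

/-- The map to `Λ` on the paths of the quotient. -/
def qMapPath : QPath hE → Λ.Path :=
  Quotient.lift X.hom.onPath fun _ _ h => h.2

theorem s_qMapPath (f : QPath hE) : (qMapPath hE f).s = qMapOb hE (qs hE f) :=
  Quotient.inductionOn f fun _ => rfl

theorem r_qMapPath (f : QPath hE) : (qMapPath hE f).r = qMapOb hE (qr hE f) :=
  Quotient.inductionOn f fun _ => rfl

theorem d_qMapPath (f : QPath hE) : Λ.d (qMapPath hE f) = qd hE f :=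
  Quotient.inductionOn f fun x => X.hom.d_onPath x

/-- The paths of the quotient from `A` to `B`. -/
def QHom (A B : QOb hE) : Type u := {f : QPath hE // qs hE f = A ∧ qr hE f = B}

/-- The class of a path, with its source and range. -/
def qHom {a b : X.graph.Ob} (f : a ⟶ b) : QHom hE (qOb hE a) (qOb hE b) :=
  ⟨qPath hE (Mor.of f), rfl, rfl⟩

theorem exists_rep_of_s {a : X.graph.Ob} {B : QOb hE} (f : QHom hE (qOb hE a) B) :
    ∃ (b : X.graph.Ob) (x : a ⟶ b), qOb hE b = B ∧ f.1 = qPath hE (Mor.of x) := by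
  obtain ⟨f, hs, hr⟩ := f
  induction f using Quotient.inductionOn with
  | h x =>
    obtain ⟨y, rfl, hy'⟩ := hE.exists_lift x ((qOb_eq hE).1 hs)
    have hxy : qPath hE x = qPath hE y := (qPath_eq hE).2 ⟨(qOb_eq hE).1 hs, hy'.symm⟩
    refine ⟨y.r, y.hom, ?_, hxy⟩
    rw [← hr]
    exact ((qOb_eq hE).2 (hE.r_rel ((qOb_eq hE).1 hs) hy'.symm)).symm

theorem exists_ob (A : QOb hE) : ∃ a, qOb hE a = A := Quotient.exists_rep A

theorem qPath_comp_congr {a b c a' b' c' : X.graph.Ob} {f : a ⟶ b} {g : b ⟶ c} {f' : a' ⟶ b'}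
    {g' : b' ⟶ c'} (h₁ : qPath hE (Mor.of f) = qPath hE (Mor.of f'))
    (h₂ : qPath hE (Mor.of g) = qPath hE (Mor.of g')) :
    qPath hE (Mor.of (f ≫ g)) = qPath hE (Mor.of (f' ≫ g')) := by
  rw [qPath_eq] at h₁ h₂ ⊢
  refine ⟨h₁.1, ?_⟩
  rw [KHom.onPath_of, KHom.onPath_of, CategoryTheory.Functor.map_comp,
    CategoryTheory.Functor.map_comp]
  exact Mor.comp_congr h₁.2 h₂.2

theorem exists_comp {A B C : QOb hE} (f : QHom hE A B) (g : QHom hE B C) :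
    ∃ h : QHom hE A C, ∀ {a b c : X.graph.Ob} (x : a ⟶ b) (y : b ⟶ c),
      f.1 = qPath hE (Mor.of x) → g.1 = qPath hE (Mor.of y) →
        h.1 = qPath hE (Mor.of (x ≫ y)) := by
  obtain ⟨a, rfl⟩ := exists_ob hE A
  obtain ⟨b, x, rfl, hx⟩ := exists_rep_of_s hE f
  obtain ⟨c, y, rfl, hy⟩ := exists_rep_of_s hE g
  exact ⟨qHom hE (x ≫ y), fun x' y' hx' hy' =>
    qPath_comp_congr hE (hx.symm.trans hx') (hy.symm.trans hy')⟩

/-- Composition in the quotient: the class of `x ≫ y` is the composite of the classes of `x` and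
`y`. -/
noncomputable def qComp {A B C : QOb hE} (f : QHom hE A B) (g : QHom hE B C) : QHom hE A C :=
  (exists_comp hE f g).choose

theorem qHom_comp {a b c : X.graph.Ob} (x : a ⟶ b) (y : b ⟶ c) :
    qComp hE (qHom hE x) (qHom hE y) = qHom hE (x ≫ y) :=
  Subtype.ext ((exists_comp hE (qHom hE x) (qHom hE y)).choose_spec x y rfl rfl)

theorem exists_qHom {a : X.graph.Ob} {B : QOb hE} (f : QHom hE (qOb hE a) B) :
    ∃ (b : X.graph.Ob) (x : a ⟶ b) (h : qOb hE b = B), h ▸ qHom hE x = f := by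
  obtain ⟨b, x, rfl, hx⟩ := exists_rep_of_s hE f
  exact ⟨b, x, rfl, Subtype.ext hx.symm⟩

/-- The identity morphisms of the quotient. -/
def qId (A : QOb hE) : QHom hE A A :=
  ⟨Quotient.lift (fun v => qPath hE (Mor.of (𝟙 v))) (fun v w h => (qPath_eq hE).2 ⟨h, by
      rw [KHom.onPath_of, KHom.onPath_of, CategoryTheory.Functor.map_id,
        CategoryTheory.Functor.map_id]
      have : X.hom.functor.obj v = X.hom.functor.obj w := hE.onOb_eq h
      rw [this]⟩) A,
    Quotient.inductionOn A fun _ => rfl, Quotient.inductionOn A fun _ => rfl⟩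

theorem qId_qOb (v : X.graph.Ob) : qId hE (qOb hE v) = qHom hE (𝟙 v) := rfl

noncomputable instance : SmallCategory (QOb hE) where
  Hom := QHom hE
  id := qId hE
  comp := qComp hE
  id_comp {A B} f := by
    obtain ⟨a, rfl⟩ := exists_ob hE A
    obtain ⟨b, x, rfl, rfl⟩ := exists_qHom hE f
    rw [qId_qOb, qHom_comp, Category.id_comp]
  comp_id {A B} f := by
    obtain ⟨a, rfl⟩ := exists_ob hE A
    obtain ⟨b, x, rfl, rfl⟩ := exists_qHom hE f
    rw [qId_qOb, qHom_comp, Category.comp_id]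
  assoc {A B C D} f g h := by
    obtain ⟨a, rfl⟩ := exists_ob hE A
    obtain ⟨b, x, rfl, rfl⟩ := exists_qHom hE f
    obtain ⟨c, y, rfl, rfl⟩ := exists_qHom hE g
    obtain ⟨d, z, rfl, rfl⟩ := exists_qHom hE h
    rw [qHom_comp, qHom_comp, qHom_comp, qHom_comp, Category.assoc]

/-- The projection to the quotient. -/
noncomputable def qFunctor : X.graph.Ob ⥤ QOb hE where
  obj := qOb hE
  map := qHom hE
  map_id v := (qId_qOb hE v).symm
  map_comp f g := (qHom_comp hE f g).symm

theorem qFunctor_map_inj {a b c : X.graph.Ob} {x : a ⟶ b} {y : a ⟶ c}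
    (h : qPath hE (Mor.of x) = qPath hE (Mor.of y)) : Mor.of x = Mor.of y :=
  (X.bijOn_from a).injOn rfl rfl ((qPath_eq hE).1 h).2

/-- Every path of the quotient that starts in the class of `a` is the class of a path that starts
in `a`. -/
theorem exists_map_eq {a : X.graph.Ob} {B : QOb hE} (f : qOb hE a ⟶ B) :
    ∃ (b : X.graph.Ob) (x : a ⟶ b), qOb hE b = B ∧
      Mor.of f = Mor.of ((qFunctor hE).map x) := by
  obtain ⟨b, x, rfl, rfl⟩ := exists_qHom hE f
  exact ⟨b, x, rfl, rfl⟩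

/-- The functor from the quotient to `Λ`. -/
def qMap : QOb hE ⥤ Λ.Ob where
  obj := qMapOb hE
  map {A B} f := (qMapPath hE f.1).cast (by rw [s_qMapPath, f.2.1]) (by rw [r_qMapPath, f.2.2])
  map_id A := by
    obtain ⟨a, rfl⟩ := exists_ob hE A
    apply Mor.of_inj
    rw [Mor.of_cast]
    exact congrArg Mor.of (X.hom.functor.map_id a)
  map_comp {A B C} f g := by
    obtain ⟨a, rfl⟩ := exists_ob hE A
    obtain ⟨b, x, rfl, rfl⟩ := exists_qHom hE f
    obtain ⟨c, y, rfl, rfl⟩ := exists_qHom hE g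
    apply Mor.of_inj
    rw [Mor.of_cast]
    refine Eq.trans ?_ (Mor.comp_congr (f := X.hom.functor.map x) (g := X.hom.functor.map y)
      (Mor.of_cast _ _ _).symm (Mor.of_cast _ _ _).symm)
    have : (qHom hE x ≫ qHom hE y : qOb hE a ⟶ qOb hE c) = qHom hE (x ≫ y) := qHom_comp hE x y
    rw [this]
    exact congrArg Mor.of (X.hom.functor.map_comp x y)

theorem of_qMap {A B : QOb hE} (f : A ⟶ B) : Mor.of ((qMap hE).map f) = qMapPath hE f.1 :=
  Mor.of_cast (qMapPath hE f.1) (by rw [s_qMapPath, f.2.1]; rfl) (by rw [r_qMapPath, f.2.2]; rfl)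

/-- Paths with equivalent ranges and equal degrees are equivalent. -/
theorem qPath_eq_of_r_d {x y : X.graph.Path} (hr : E x.r y.r) (hd : X.graph.d x = X.graph.d y) :
    qPath hE x = qPath hE y := by
  by_cases hx : x.IsId
  · have hy : y.IsId := X.graph.isId_of_d_eq_zero (by rw [← hd, X.graph.d_isId hx])
    obtain ⟨v, rfl⟩ := hx
    obtain ⟨w, rfl⟩ := hy
    have h : qOb hE v = qOb hE w := (qOb_eq hE).2 hr
    exact congrArg (fun A => (qId hE A).1) h
  · have h₁ : (Walk.single (.bwd x hx)).map X.hom ∈ X.walkImage x.r := ⟨_, rfl, rfl⟩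
    have h₂ : X.walkImage x.r = X.walkImage y.r := hE.le_sim _ _ hr
    rw [h₂] at h₁
    obtain ⟨q, hq, hq'⟩ := h₁
    have he : q.edges.map (WalkEdge.map X.hom) = [(WalkEdge.bwd x hx).map X.hom] :=
      congrArg Walk.edges hq'
    rw [List.map_eq_singleton_iff] at he
    obtain ⟨e, hqe, he⟩ := he
    have hs : e.s = y.r := by
      have hq : q.s = y.r := hq
      rw [← hq]
      simp [Walk.s, hqe]
    cases e with
    | fwd z => simp [WalkEdge.map] at he
    | bwd z hz =>
      have hzx : X.hom.onPath z = X.hom.onPath x := by simpa [WalkEdge.map] using he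
      have hdz : X.graph.d z = X.graph.d y := by
        rw [← hd, ← X.hom.d_onPath, ← X.hom.d_onPath, hzx]
      obtain rfl : z = y := (X.existsUnique_to y.r (X.graph.d y)).unique ⟨hs, hdz⟩ ⟨rfl, rfl⟩
      refine (qPath_eq hE).2 ⟨?_, hzx.symm⟩
      exact hE.range_rel (Walk.single (.bwd x hx)) (Walk.single (.bwd z hz)) hr
        (Walk.ext (by simp [Walk.map, Walk.single, WalkEdge.map, hzx]))

/-- Paths of the quotient are determined by their underlying classes. -/
theorem of_hom_eq {A B A' B' : QOb hE} {f : A ⟶ B} {g : A' ⟶ B'} (h : f.1 = g.1) :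
    Mor.of f = Mor.of g := by
  obtain ⟨f, rfl, rfl⟩ := f
  obtain ⟨g, rfl, rfl⟩ := g
  obtain rfl : f = g := h
  rfl

theorem existsUnique_qTo (A : QOb hE) (n : Fin k → ℕ) :
    ∃! f : Mor (QOb hE), f.r = A ∧ qd hE f.hom.1 = n := by
  obtain ⟨a, rfl⟩ := exists_ob hE A
  obtain ⟨x, hx, -⟩ := X.existsUnique_to a n
  obtain ⟨rfl, rfl⟩ := hx
  refine ⟨⟨_, _, qHom hE x.hom⟩, ⟨rfl, rfl⟩, ?_⟩
  rintro ⟨B, C, f⟩ ⟨hr, hd⟩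
  have hr : C = qOb hE x.r := hr
  subst hr
  obtain ⟨b, rfl⟩ := exists_ob hE B
  obtain ⟨c, y, hc, hy⟩ := exists_rep_of_s hE f
  apply of_hom_eq
  refine hy.trans (qPath_eq_of_r_d hE ((qOb_eq hE).1 hc) ?_)
  have hd : qd hE f.1 = X.graph.d x := hd
  rw [hy] at hd
  exact hd

/-- The quotient, as a `k`-graph. -/
noncomputable def quotientGraph : KGraph.{u} k where
  Ob := QOb hE
  deg {A B} f := qd hE (f : QHom hE A B).1
  deg_id A := by
    obtain ⟨a, rfl⟩ := exists_ob hE A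
    exact X.graph.deg_id a
  deg_comp {A B C} f g := by
    obtain ⟨a, rfl⟩ := exists_ob hE A
    obtain ⟨b, x, rfl, rfl⟩ := exists_qHom hE f
    obtain ⟨c, y, rfl, rfl⟩ := exists_qHom hE g
    have : (qHom hE x ≫ qHom hE y : qOb hE a ⟶ qOb hE c) = qHom hE (x ≫ y) := qHom_comp hE x y
    change qd hE (qHom hE x ≫ qHom hE y : qOb hE a ⟶ qOb hE c).1 = _
    rw [this]
    exact X.graph.deg_comp x y
  factorisation {A C} f m n hf := by
    obtain ⟨a, rfl⟩ := exists_ob hE A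
    obtain ⟨c, z, rfl, rfl⟩ := exists_qHom hE f
    obtain ⟨⟨b, x, y⟩, ⟨hm, hn, hxy⟩, hu⟩ := X.graph.factorisation z m n hf
    refine ⟨⟨qOb hE b, qHom hE x, qHom hE y⟩, ⟨hm, hn, ?_⟩, ?_⟩
    · have hxy : x ≫ y = z := hxy
      rw [← hxy]
      exact qHom_comp hE x y
    · rintro ⟨B, f, g⟩ ⟨hm', hn', hfg⟩
      obtain ⟨b', x', rfl, rfl⟩ := exists_qHom hE f
      obtain ⟨c', y', hc, hy⟩ := exists_rep_of_s hE g
      have hfg : qComp hE (qHom hE x') g = qHom hE z := hfg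
      have h₁ : qPath hE (Mor.of (x' ≫ y')) = qPath hE (Mor.of z) := by
        rw [← (exists_comp hE (qHom hE x') g).choose_spec x' y' rfl hy]
        exact congrArg Subtype.val hfg
      have h₂ := qFunctor_map_inj hE h₁
      obtain rfl : c' = c := congrArg Mor.r h₂
      have h₃ := Mor.of_inj h₂
      have hg : g = qHom hE y' := Subtype.ext hy
      subst hg
      have h₄ := hu ⟨b', x', y'⟩ ⟨hm', hn', h₃⟩
      obtain rfl : b' = b := congrArg Sigma.fst h₄
      simp only [Sigma.mk.injEq, heq_eq_eq, Prod.mk.injEq, true_and] at h₄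
      rw [h₄.1, h₄.2]
  connected := by
    have : Nonempty (QOb hE) := X.graph.connected.is_nonempty.map (qOb hE)
    refine zigzag_isConnected fun A B => ?_
    obtain ⟨a, rfl⟩ := exists_ob hE A
    obtain ⟨b, rfl⟩ := exists_ob hE B
    exact zigzag_obj_of_zigzag (qFunctor hE) (isPreconnected_zigzag a b)
  rowFinite A n := Set.Subsingleton.finite fun _ hf _ hg =>
    (existsUnique_qTo hE A n).unique hf hg
  noSources A n := (existsUnique_qTo hE A n).exists

/-- The quotient of a representation `k`-graph by an admissible equivalence relation. -/
noncomputable def quotient (X : RG Λ) (E : Setoid X.graph.Ob) (hE : X.IsAdmissible E) : RG Λ where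
  graph := quotientGraph hE
  hom := ⟨qMap hE, fun f => (congrArg Λ.d (of_qMap hE f)).trans (d_qMapPath hE f.1)⟩
  bijOn_from A := by
    obtain ⟨a, rfl⟩ := exists_ob hE A
    refine ⟨?_, ?_, ?_⟩
    · rintro ⟨B, C, f⟩ rfl
      rfl
    · rintro ⟨B, C, f⟩ hB ⟨B', C', g⟩ hB' h
      obtain rfl : B = qOb hE a := hB
      obtain rfl : B' = qOb hE a := hB'
      obtain ⟨c, x, rfl, rfl⟩ := exists_qHom hE f
      obtain ⟨c', y, rfl, rfl⟩ := exists_qHom hE g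
      have h' := ((of_qMap hE (qHom hE x)).symm.trans h).trans (of_qMap hE (qHom hE y))
      exact of_hom_eq hE ((qPath_eq hE).2 ⟨E.refl _, h'⟩)
    · intro y hy
      obtain ⟨x, rfl, rfl⟩ := (X.bijOn_from a).surjOn hy
      exact ⟨⟨_, _, qHom hE x.hom⟩, rfl, of_qMap hE (qHom hE x.hom)⟩
  existsUnique_to A n := existsUnique_qTo hE A n

end Quotient

/-- The quotient by the relation `∼`. -/
noncomputable def quotientSim (X : RG Λ) : RG Λ := X.quotient X.sim X.sim_isAdmissible

end RG

end RepKG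

/-! The proof rests on one invariant: the set of all walk images `X.walkImage v`, a family of
subsets of the walks in `Λ`. A morphism `X ⟶ Y` lifts paths at both ends: at the source because both
graphs biject onto the paths of `Λ`, at the range because there is exactly one path of each degree.
So it is surjective on vertices (`surjective_onOb`) and lifts walks, hence it preserves walk images
(`walkImage_onOb`), and the family is constant on connected components.

In an irreducible `Y` a vertex is the same thing as its walk image, and following a path changes the
walk image in a way that only its image in `Λ` determines. Hence a morphism into `Y` exists once all
walk images of the source occur in `Y` (`Irreducible.nonempty_hom`), and it is unique
(`Irreducible.hom_eq`). Two irreducible objects of one component are therefore isomorphic. The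
covering map and the projection to the quotient are morphisms, so the quotient lies in the
component; since the projection preserves walk images, it is irreducible.

A universal covering is built from classes of walks: localise the category at all its morphisms, and
take the category of elements of the functor represented by a vertex. The monodromy of any covering
inverts all paths, so it factors through the localisation and provides the comparison map. -/

namespace RepKG

variable {k : ℕ}

/-! ### Lifting paths and walks along `k`-graph morphisms -/

namespace KHom

theorem ext_of_onPath {Δ Λ : KGraph.{u} k} {φ ψ : KHom Δ Λ}
    (h : ∀ x, φ.onPath x = ψ.onPath x) : φ = ψ := by
  refine KHom.ext (Functor.hext (fun v => congrArg Mor.s (h (Mor.of (𝟙 v)))) fun a b f => ?_)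
  have hf := h (Mor.of f)
  simp only [onPath, Mor.map, Mor.of, Mor.mk.injEq] at hf
  exact hf.2.2

theorem onPath_id {Δ Λ : KGraph.{u} k} (α : KHom Δ Λ) (v : Δ.Ob) :
    α.onPath (Mor.of (𝟙 v)) = Mor.of (𝟙 (α.onOb v)) := by
  rw [onPath_of, α.functor.map_id]
  rfl

/-- A map on vertices extends to a lift of `α` through `β` when every path lifts along it. -/
theorem exists_lift {Δ S Λ : KGraph.{u} k} (α : KHom Δ Λ) (β : KHom S Λ)
    (hβ : ∀ v, Set.InjOn β.onPath (S.pathsFrom v)) (o : Δ.Ob → S.Ob)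
    (h : ∀ x : Δ.Path, ∃ y : S.Path, y.s = o x.s ∧ y.r = o x.r ∧ β.onPath y = α.onPath x) :
    ∃ φ : KHom Δ S, φ.comp β = α ∧ ∀ v, φ.onOb v = o v := by
  choose l hs hr hl using h
  -- Functoriality of the chosen lifts is uniqueness of lifts: two paths of `S` with the same source
  -- and the same image under `β` agree.
  have hid (v : Δ.Ob) : l (Mor.of (𝟙 v)) = Mor.of (𝟙 (o v)) := by
    refine hβ (o v) (hs _) rfl ?_
    have hv : α.onOb v = β.onOb (o v) := by
      have h₁ := congrArg Mor.s (hl (Mor.of (𝟙 v)))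
      have h₂ : β.onOb (l (Mor.of (𝟙 v))).s = α.onOb v := h₁
      rw [← h₂, hs]
      rfl
    rw [hl, onPath_id, onPath_id, hv]
  have hs' {a b : Δ.Ob} (f : a ⟶ b) : (l (Mor.of f)).s = o a := hs _
  have hr' {a b : Δ.Ob} (f : a ⟶ b) : (l (Mor.of f)).r = o b := hr _
  let F : Δ.Ob ⥤ S.Ob :=
    { obj := o
      map := fun {a b} f => (l (Mor.of f)).cast (hs' f) (hr' f)
      map_id := fun v => Mor.of_inj ((Mor.of_cast _ (hs' _) (hr' _)).trans (hid v))
      map_comp := fun {a b c} f g => Mor.of_inj (by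
        rw [Mor.of_cast _ (hs' _) (hr' _)]
        refine hβ (o a) (hs _) rfl ?_
        rw [hl, onPath_of, onPath_of, Functor.map_comp, Functor.map_comp]
        refine Mor.comp_congr ?_ ?_
        · rw [← onPath_of, ← onPath_of, Mor.of_cast, hl]
        · rw [← onPath_of, ← onPath_of, Mor.of_cast, hl]) }
  have hF (x : Δ.Path) : β.onPath (x.map F) = α.onPath x := by
    have : x.map F = l x := Mor.of_cast (l x) (hs x) (hr x)
    rw [this, hl]
  refine ⟨⟨F, fun f => ?_⟩, ext_of_onPath hF, fun v => rfl⟩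
  have h₁ : Λ.d (β.onPath ((Mor.of f).map F)) = Δ.deg f := by
    rw [hF]
    exact α.d_onPath (Mor.of f)
  rw [β.d_onPath] at h₁
  exact h₁

/-- A morphism with path lifting at both ends is surjective on vertices. -/
theorem surjective_onOb {Δ Λ : KGraph.{u} k} (φ : KHom Δ Λ)
    (hf : ∀ v, Set.SurjOn φ.onPath (Δ.pathsFrom v) (Λ.pathsFrom (φ.onOb v)))
    (ht : ∀ v, Set.SurjOn φ.onPath (Δ.pathsTo v) (Λ.pathsTo (φ.onOb v))) :
    Function.Surjective φ.onOb := by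
  obtain ⟨v₀⟩ := Δ.connected.is_nonempty
  -- The set of vertices hit is closed under moving along a path in either direction, and `Λ` is
  -- connected.
  refine induct_on_objects (Set.range φ.onOb) ⟨v₀, rfl⟩ fun {a b} f => ⟨?_, ?_⟩
  · rintro ⟨v, rfl⟩
    obtain ⟨x, -, hx⟩ := hf v (show Mor.of f ∈ Λ.pathsFrom _ from rfl)
    exact ⟨x.r, congrArg Mor.r hx⟩
  · rintro ⟨v, rfl⟩
    obtain ⟨x, -, hx⟩ := ht v (show Mor.of f ∈ Λ.pathsTo _ from rfl)
    exact ⟨x.s, congrArg Mor.s hx⟩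

theorem exists_edge_lift {Δ Λ : KGraph.{u} k} (φ : KHom Δ Λ)
    (hf : ∀ v, Set.SurjOn φ.onPath (Δ.pathsFrom v) (Λ.pathsFrom (φ.onOb v)))
    (ht : ∀ v, Set.SurjOn φ.onPath (Δ.pathsTo v) (Λ.pathsTo (φ.onOb v)))
    (v : Δ.Ob) (e : WalkEdge Λ.Ob) (he : e.s = φ.onOb v) :
    ∃ e' : WalkEdge Δ.Ob, e'.s = v ∧ e'.map φ = e := by
  cases e with
  | fwd y =>
    obtain ⟨x, hx, rfl⟩ := hf v he
    exact ⟨.fwd x, hx, rfl⟩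
  | bwd y hy =>
    obtain ⟨x, hx, rfl⟩ := ht v he
    refine ⟨.bwd x fun h => hy ?_, hx, rfl⟩
    obtain ⟨w, rfl⟩ := h
    exact ⟨φ.onOb w, φ.onPath_id w⟩

/-- Stating the source conditions through `head?` admits the empty list, which serves as the base of
the induction. -/
theorem exists_edges_lift {Δ Λ : KGraph.{u} k} (φ : KHom Δ Λ)
    (hf : ∀ v, Set.SurjOn φ.onPath (Δ.pathsFrom v) (Λ.pathsFrom (φ.onOb v)))
    (ht : ∀ v, Set.SurjOn φ.onPath (Δ.pathsTo v) (Λ.pathsTo (φ.onOb v)))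
    (l : List (WalkEdge Λ.Ob)) : ∀ v : Δ.Ob, l.IsChain (fun e e' => e.r = e'.s) →
    (∀ e ∈ l.head?, e.s = φ.onOb v) →
    ∃ l' : List (WalkEdge Δ.Ob), l'.IsChain (fun e e' => e.r = e'.s) ∧
      (∀ e ∈ l'.head?, e.s = v) ∧ l'.map (WalkEdge.map φ) = l := by
  induction l with
  | nil => exact fun v _ _ => ⟨[], by simp, by simp, rfl⟩
  | cons e l ih =>
    intro v hc hv
    obtain ⟨e, rfl, rfl⟩ := φ.exists_edge_lift hf ht v e (hv e (by simp))
    rw [List.isChain_cons] at hc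
    obtain ⟨l', hl', hv', rfl⟩ := ih e.r hc.2 fun a ha => by
      rw [← hc.1 a ha, WalkEdge.r_map]
    refine ⟨e :: l', List.isChain_cons.2 ⟨fun a ha => (hv' a ha).symm, hl'⟩, by simp, by simp⟩

/-- Walks lift along a morphism with path lifting at both ends. -/
theorem exists_walk_lift {Δ Λ : KGraph.{u} k} (φ : KHom Δ Λ)
    (hf : ∀ v, Set.SurjOn φ.onPath (Δ.pathsFrom v) (Λ.pathsFrom (φ.onOb v)))
    (ht : ∀ v, Set.SurjOn φ.onPath (Δ.pathsTo v) (Λ.pathsTo (φ.onOb v)))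
    (v : Δ.Ob) (q : Walk Λ.Ob) (hq : q.s = φ.onOb v) :
    ∃ p : Walk Δ.Ob, p.s = v ∧ p.map φ = q := by
  obtain ⟨l, hc, hl, h⟩ := φ.exists_edges_lift hf ht q.edges v q.chain fun e he => by
    rw [List.head?_eq_some_head q.ne_nil, Option.mem_some_iff] at he
    rw [← he]
    exact hq
  have hne : l ≠ [] := by
    rintro rfl
    exact q.ne_nil h.symm
  exact ⟨⟨l, hne, hc⟩, hl _ (by simp [List.head?_eq_some_head hne]), Walk.ext h⟩

end KHom

/-! ### Walk images as an invariant, and irreducible objects -/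

namespace RG

variable {Λ : KGraph.{u} k}

theorem onPath_comm {X Y : RG Λ} (φ : X ⟶ Y) (x : X.graph.Path) :
    Y.hom.onPath (φ.hom.onPath x) = X.hom.onPath x := by
  rw [← φ.comm]
  rfl

theorem onOb_comm {X Y : RG Λ} (φ : X ⟶ Y) (v : X.graph.Ob) :
    Y.hom.onOb (φ.hom.onOb v) = X.hom.onOb v := by
  rw [← φ.comm]
  rfl

theorem surjOn_from {X Y : RG Λ} (φ : X ⟶ Y) (v : X.graph.Ob) :
    Set.SurjOn φ.hom.onPath (X.graph.pathsFrom v) (Y.graph.pathsFrom (φ.hom.onOb v)) := by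
  intro y hy
  have hy' : Y.hom.onPath y ∈ Λ.pathsFrom (X.hom.onOb v) := by
    rw [← onOb_comm φ]
    exact (Y.bijOn_from _).mapsTo hy
  obtain ⟨x, hx, hxy⟩ := (X.bijOn_from v).surjOn hy'
  refine ⟨x, hx, (Y.bijOn_from _).injOn ?_ hy ((onPath_comm φ x).trans hxy)⟩
  exact congrArg φ.hom.onOb hx

/-- Each side has exactly one path of a given degree into the vertex, and `φ` preserves degrees, so
these two paths correspond. -/
theorem surjOn_to {X Y : RG Λ} (φ : X ⟶ Y) (v : X.graph.Ob) :
    Set.SurjOn φ.hom.onPath (X.graph.pathsTo v) (Y.graph.pathsTo (φ.hom.onOb v)) := by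
  intro y hy
  obtain ⟨x, hx, -⟩ := X.existsUnique_to v (Y.graph.d y)
  refine ⟨x, hx.1, (Y.existsUnique_to _ (Y.graph.d y)).unique ⟨?_, ?_⟩ ⟨hy, rfl⟩⟩
  · exact congrArg φ.hom.onOb hx.1
  · rw [φ.hom.d_onPath, hx.2]

theorem surjective_onOb {X Y : RG Λ} (φ : X ⟶ Y) : Function.Surjective φ.hom.onOb :=
  φ.hom.surjective_onOb (surjOn_from φ) (surjOn_to φ)

theorem map_map {X Y : RG Λ} (φ : X ⟶ Y) (p : Walk X.graph.Ob) :
    (p.map φ.hom).map Y.hom = p.map X.hom := by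
  refine Walk.ext ?_
  simp only [Walk.map, List.map_map]
  refine List.map_congr_left fun e _ => ?_
  cases e with
  | fwd x => simp [WalkEdge.map, onPath_comm φ]
  | bwd x hx => simp [WalkEdge.map, onPath_comm φ]

/-- Morphisms of representation `k`-graphs preserve the images of walks. -/
theorem walkImage_onOb {X Y : RG Λ} (φ : X ⟶ Y) (v : X.graph.Ob) :
    Y.walkImage (φ.hom.onOb v) = X.walkImage v := by
  refine Set.Subset.antisymm ?_ ?_
  · rintro _ ⟨q, hq, rfl⟩
    obtain ⟨p, hp, rfl⟩ := φ.hom.exists_walk_lift (surjOn_from φ) (surjOn_to φ) v q hq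
    exact ⟨p, hp, (map_map φ p).symm⟩
  · rintro _ ⟨p, hp, rfl⟩
    exact ⟨p.map φ.hom, (Walk.s_map _ _).trans (congrArg φ.hom.onOb hp), map_map φ p⟩

theorem range_walkImage_eq_of_hom {X Y : RG Λ} (φ : X ⟶ Y) :
    Set.range X.walkImage = Set.range Y.walkImage := by
  rw [← (surjective_onOb φ).range_comp]
  congr 1
  funext v
  exact (walkImage_onOb φ v).symm

/-- The set of all walk images is an invariant of connected components. -/
theorem range_walkImage_eq_of_zigzag {X Y : RG Λ} (h : Zigzag X Y) :
    Set.range X.walkImage = Set.range Y.walkImage := by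
  induction h with
  | refl => rfl
  | tail _ h ih =>
    rcases h with ⟨⟨φ⟩⟩ | ⟨⟨φ⟩⟩
    · exact ih.trans (range_walkImage_eq_of_hom φ)
    · exact ih.trans (range_walkImage_eq_of_hom φ).symm

/-- The walk made of one identity edge lies in the image, and its source shows the vertex of `Λ`. -/
theorem onOb_eq_of_walkImage_eq {X Y : RG Λ} {v : X.graph.Ob} {w : Y.graph.Ob}
    (h : X.walkImage v = Y.walkImage w) : X.hom.onOb v = Y.hom.onOb w := by
  have h₁ : (Walk.single (.fwd (Mor.of (𝟙 v)))).map X.hom ∈ X.walkImage v := ⟨_, rfl, rfl⟩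
  rw [h] at h₁
  obtain ⟨q, hq, hq'⟩ := h₁
  have h₃ := congrArg Walk.s hq'
  rw [Walk.s_map, Walk.s_map, show q.s = w from hq] at h₃
  exact h₃.symm

/-- The image of the walks from the range of `x` is determined by the image of the walks from its
source and by the image of `x`. -/
theorem mem_walkImage_range (X : RG Λ) (x : X.graph.Path) (w : Walk Λ.Ob) :
    w ∈ X.walkImage x.r ↔
      ∃ z ∈ X.walkImage x.s, z.edges = .fwd (X.hom.onPath x) :: w.edges := by
  constructor
  · rintro ⟨p, hp, rfl⟩
    exact ⟨_, ⟨(Walk.single (.fwd x)).append p (Eq.symm hp), Walk.s_append _ _ _, rfl⟩, rfl⟩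
  · rintro ⟨_, ⟨p, hp, rfl⟩, he⟩
    obtain ⟨l, hne, hc⟩ := p
    obtain ⟨e, l, rfl⟩ := List.exists_cons_of_ne_nil hne
    have he : e.map X.hom :: l.map (WalkEdge.map X.hom) = _ := he
    rw [List.cons.injEq] at he
    -- A lift of an edge is determined by its source, so the first edge of `p` has to be `x`, and
    -- the rest is a walk from the range of `x`.
    obtain rfl : e = .fwd x := X.edge_ext hp he.1
    have hl : l ≠ [] := by
      rintro rfl
      exact w.ne_nil he.2.symm
    rw [List.isChain_cons] at hc
    exact ⟨⟨l, hl, hc.2⟩, (hc.1 _ (by simp [List.head?_eq_some_head hl])).symm, Walk.ext he.2⟩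

theorem walkImage_range_eq {X Y : RG Λ} {x : X.graph.Path} {y : Y.graph.Path}
    (hs : X.walkImage x.s = Y.walkImage y.s) (h : X.hom.onPath x = Y.hom.onPath y) :
    X.walkImage x.r = Y.walkImage y.r := by
  ext w
  rw [mem_walkImage_range, mem_walkImage_range, hs, h]

theorem Irreducible.injective {X : RG Λ} (hX : X.Irreducible) :
    Function.Injective X.walkImage := by
  intro v w h
  by_contra hne
  exact hX v w hne h

/-- Send each vertex to the vertex of `Y` with the same walk image. A path then lifts from the
prescribed source, and its range is the prescribed one because the two have equal walk images. -/
theorem Irreducible.nonempty_hom {X Y : RG Λ} (hY : Y.Irreducible)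
    (h : Set.range X.walkImage ⊆ Set.range Y.walkImage) : Nonempty (X ⟶ Y) := by
  choose o ho using fun v => h (Set.mem_range_self v)
  obtain ⟨φ, hφ, -⟩ := KHom.exists_lift X.hom Y.hom (fun v => (Y.bijOn_from v).injOn) o fun x => by
    have hx : X.hom.onPath x ∈ Λ.pathsFrom (Y.hom.onOb (o x.s)) :=
      onOb_eq_of_walkImage_eq (ho x.s).symm
    obtain ⟨y, hy, hxy⟩ := (Y.bijOn_from (o x.s)).surjOn hx
    refine ⟨y, hy, hY.injective ?_, hxy⟩
    rw [ho]
    exact walkImage_range_eq (by rw [show y.s = o x.s from hy, ho]) hxy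
  exact ⟨⟨φ, hφ⟩⟩

/-- Both morphisms preserve walk images, hence agree on vertices; paths of `Y` with a common source
are separated by their images in `Λ`. -/
theorem Irreducible.hom_eq {X Y : RG Λ} (hY : Y.Irreducible) (φ ψ : X ⟶ Y) : φ = ψ := by
  refine Hom.ext (KHom.ext_of_onPath fun x => ?_)
  have hs : φ.hom.onOb x.s = ψ.hom.onOb x.s :=
    hY.injective ((walkImage_onOb φ _).trans (walkImage_onOb ψ _).symm)
  exact (Y.bijOn_from _).injOn hs rfl ((onPath_comm φ x).trans (onPath_comm ψ x).symm)

theorem Irreducible.nonempty_iso {X Y : RG Λ} (hX : X.Irreducible) (hY : Y.Irreducible)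
    (h : Zigzag X Y) : Nonempty (X ≅ Y) := by
  have he := range_walkImage_eq_of_zigzag h
  obtain ⟨φ⟩ := hY.nonempty_hom he.subset
  obtain ⟨ψ⟩ := hX.nonempty_hom he.symm.subset
  exact ⟨⟨φ, ψ, hX.hom_eq _ _, hY.hom_eq _ _⟩⟩

/-- A covering of `X`, as a morphism of representation `k`-graphs. -/
def ofCoveringHom (X : RG Λ) (T : Covering X.graph) : X.ofCovering T ⟶ X :=
  (⟨T.hom, rfl⟩ : Hom _ _)

/-- The projection to the quotient, as a morphism of representation `k`-graphs. -/
noncomputable def quotientHom (X : RG Λ) (E : Setoid X.graph.Ob) (hE : X.IsAdmissible E) :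
    X ⟶ X.quotient E hE :=
  let φ : KHom X.graph (X.quotient E hE).graph := ⟨qFunctor hE, fun _ => rfl⟩
  (⟨φ, KHom.ext_of_onPath fun x => of_qMap hE (qHom hE x.hom)⟩ : Hom X (X.quotient E hE))

/-- The projection is a morphism, so a class has the walk image of any of its representatives; equal
walk images then mean equal classes. -/
theorem quotientSim_irreducible (X : RG Λ) : X.quotientSim.Irreducible := by
  intro A B hne h
  have hE := X.sim_isAdmissible
  obtain ⟨a, rfl⟩ := exists_ob hE A
  obtain ⟨b, rfl⟩ := exists_ob hE B
  refine hne ((qOb_eq hE).2 ?_)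
  have ha := walkImage_onOb (X.quotientHom X.sim hE) a
  have hb := walkImage_onOb (X.quotientHom X.sim hE) b
  exact ha.symm.trans (h.trans hb)

end RG

end RepKG

/-! ### Coverings from categories of elements -/

namespace RepKG

variable {k : ℕ}

namespace KGraph

variable (Λ : KGraph.{u} k) (F : Λ.Ob ⥤ Type u)

/-- The category of elements of a functor that sends all paths to bijections, as a `k`-graph. -/
def elements [IsConnected F.Elements]
    (hF : ∀ {a b : Λ.Ob} (f : a ⟶ b), Function.Bijective (F.map f)) : KGraph.{u} k where
  Ob := F.Elements
  cat := categoryOfElements F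
  deg f := Λ.deg f.1
  deg_id a := Λ.deg_id a.1
  deg_comp f g := Λ.deg_comp f.1 g.1
  factorisation := by
    rintro ⟨a, x⟩ ⟨c, z⟩ ⟨f, hf⟩ m n h
    obtain ⟨⟨b, g₁, g₂⟩, ⟨h₁, h₂, h₃⟩, hu⟩ := Λ.factorisation f m n h
    have h₃ : g₁ ≫ g₂ = f := h₃
    have hf : F.map f x = z := hf
    -- The middle vertex of a factorisation has no freedom: its element must be the transport of `x`
    -- along the first factor.
    refine ⟨⟨⟨b, F.map g₁ x⟩, ⟨g₁, rfl⟩, ⟨g₂, ?_⟩⟩, ⟨h₁, h₂, Subtype.ext h₃⟩, ?_⟩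
    · subst h₃
      rw [← hf]
      simp
    · rintro ⟨⟨b', y⟩, ⟨g₁', hg₁⟩, ⟨g₂', hg₂⟩⟩ ⟨h₁', h₂', h₃'⟩
      have h₄ := hu ⟨b', g₁', g₂'⟩ ⟨h₁', h₂', congrArg Subtype.val h₃'⟩
      obtain rfl : b' = b := congrArg Sigma.fst h₄
      simp only [Sigma.mk.injEq, heq_eq_eq, Prod.mk.injEq, true_and] at h₄
      obtain ⟨rfl, rfl⟩ := h₄
      change a ⟶ b' at g₁'
      obtain rfl : F.map g₁' x = y := hg₁
      rfl
  connected := inferInstance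
  rowFinite := by
    rintro ⟨v, x⟩ n
    -- The projection is injective on paths into a fixed vertex, since `F.map f` is injective;
    -- finiteness is inherited from `Λ`.
    refine Set.Finite.of_finite_image ((Λ.rowFinite v n).subset ?_)
      (f := Mor.map (CategoryOfElements.π F)) ?_
    · rintro _ ⟨⟨a, b, f⟩, ⟨hb, hd⟩, rfl⟩
      exact ⟨congrArg Sigma.fst hb, hd⟩
    · rintro ⟨⟨a, y⟩, b, ⟨f, hf⟩⟩ ⟨hb, -⟩ ⟨⟨a', y'⟩, b', ⟨f', hf'⟩⟩ ⟨hb', -⟩ h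
      obtain rfl : b = ⟨v, x⟩ := hb
      obtain rfl : b' = ⟨v, x⟩ := hb'
      obtain rfl : a = a' := congrArg Mor.s h
      obtain rfl : f = f' := Mor.of_inj h
      obtain rfl : y = y' := (hF f).1 (hf.trans hf'.symm)
      rfl
  noSources := by
    rintro ⟨v, x⟩ n
    obtain ⟨⟨a, b, f⟩, rfl, hd⟩ := Λ.noSources v n
    obtain ⟨y, hy⟩ := (hF f).2 x
    exact ⟨⟨⟨a, y⟩, ⟨b, x⟩, ⟨f, hy⟩⟩, rfl, hd⟩

/-- The projection from the category of elements, as a covering. -/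
def elementsCovering [IsConnected F.Elements]
    (hF : ∀ {a b : Λ.Ob} (f : a ⟶ b), Function.Bijective (F.map f)) : Covering Λ where
  graph := Λ.elements F hF
  hom :=
    { functor := (CategoryOfElements.π F :)
      deg_map := fun _ => rfl }
  bijOn_from := by
    rintro (w : F.Elements)
    obtain ⟨v, x⟩ := w
    refine ⟨?_, ?_, ?_⟩
    · exact fun y hy => congrArg Sigma.fst hy
    · rintro ⟨a, ⟨b, y⟩, ⟨f, hf⟩⟩ ha ⟨a', ⟨b', y'⟩, ⟨f', hf'⟩⟩ ha' h
      obtain rfl : a = ⟨v, x⟩ := ha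
      obtain rfl : a' = ⟨v, x⟩ := ha'
      obtain rfl : b = b' := congrArg Mor.r h
      obtain rfl : f = f' := Mor.of_inj h
      obtain rfl : y = y' := hf.symm.trans hf'
      rfl
    · rintro ⟨a, b, f⟩ ha
      obtain rfl : a = v := ha
      exact ⟨⟨⟨a, x⟩, ⟨b, F.map f x⟩, ⟨f, rfl⟩⟩, rfl, rfl⟩
  bijOn_to := by
    rintro (w : F.Elements)
    obtain ⟨v, x⟩ := w
    refine ⟨?_, ?_, ?_⟩
    · exact fun y hy => congrArg Sigma.fst hy
    · rintro ⟨⟨a, y⟩, b, ⟨f, hf⟩⟩ hb ⟨⟨a', y'⟩, b', ⟨f', hf'⟩⟩ hb' h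
      obtain rfl : b = ⟨v, x⟩ := hb
      obtain rfl : b' = ⟨v, x⟩ := hb'
      obtain rfl : a = a' := congrArg Mor.s h
      obtain rfl : f = f' := Mor.of_inj h
      obtain rfl : y = y' := (hF f).1 (hf.trans hf'.symm)
      rfl
    · rintro ⟨a, b, f⟩ hb
      obtain rfl : b = v := hb
      obtain ⟨y, hy⟩ := (hF f).2 x
      exact ⟨⟨⟨a, y⟩, ⟨b, x⟩, ⟨f, hy⟩⟩, rfl, rfl⟩

end KGraph

/-! ### Classes of walks, via the localisation at all morphisms -/

/-- The covariant functor from `C` represented by `a` in the localisation of `C` at all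
morphisms: its values are the classes of walks that start in `a`. -/
noncomputable abbrev walkFunctor {C : Type u} [SmallCategory C] (a : C) : C ⥤ Type u :=
  (⊤ : MorphismProperty C).Q ⋙
    coyoneda.obj (Opposite.op ((⊤ : MorphismProperty C).Q.obj a))

theorem walkFunctor_map_bijective {C : Type u} [SmallCategory C] (a : C) {b c : C} (f : b ⟶ c) :
    Function.Bijective ((walkFunctor a).map f) := by
  have : IsIso ((⊤ : MorphismProperty C).Q.map f) :=
    (⊤ : MorphismProperty C).Q_inverts f trivial
  exact (isIso_iff_bijective _).1 (inferInstanceAs (IsIso ((coyoneda.obj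
    (Opposite.op ((⊤ : MorphismProperty C).Q.obj a))).map ((⊤ : MorphismProperty C).Q.map f))))

/-- Every morphism of the localisation is composed of images of paths and inverses of such. Each of
these generators links two elements by a path, so every element is linked to the identity at `a`. -/
theorem walkFunctor_elements_isConnected {C : Type u} [SmallCategory C] (a : C) :
    IsConnected (walkFunctor a).Elements := by
  let W : MorphismProperty C := ⊤
  refine IsConnected.of_induct (j₀ := ⟨a, 𝟙 (W.Q.obj a)⟩) fun p h₀ hp => ?_
  let e (b : W.Localization) (g : W.Q.obj a ⟶ b) : (walkFunctor a).Elements := ⟨b.as.obj, g⟩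
  -- `P h` says that composing with `h` does not affect membership in `p`. Proving it for generators
  -- proves it for every `g`, and applying it to the identity at `a` reaches the element `g`.
  let P : MorphismProperty W.Localization := fun b c h =>
    ∀ g : W.Q.obj a ⟶ b, e b g ∈ p ↔ e c (g ≫ h) ∈ p
  have : P.IsStableUnderComposition :=
    ⟨fun f g hf hg i => by rw [hf, hg, Category.assoc]⟩
  have hP : P = ⊤ := by
    refine Localization.Construction.morphismProperty_eq_top' P (fun b c f g => ?_) ?_
    · let m : e (W.Q.obj b) g ⟶ e (W.Q.obj c) (g ≫ W.Q.map f) := ⟨f, rfl⟩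
      exact hp m
    · intro b c i hi g
      rw [hi, Category.assoc, i.inv_hom_id, Category.comp_id]
  rintro ⟨b, g⟩
  have hg : P (X := W.Q.obj a) (Y := W.Q.obj b) g := by
    rw [hP]
    trivial
  have h : e (W.Q.obj b) (𝟙 (W.Q.obj a) ≫ g) ∈ p := (hg (𝟙 _)).1 h₀
  rw [Category.id_comp (X := W.Q.obj a) (Y := W.Q.obj b)] at h
  exact h

/-! ### Monodromy of a covering -/

namespace Covering

variable {Λ : KGraph.{u} k} (T : Covering Λ)

theorem surjective_onOb : Function.Surjective T.hom.onOb :=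
  T.hom.surjective_onOb (fun v => (T.bijOn_from v).surjOn) fun v => (T.bijOn_to v).surjOn

theorem exists_lift {a b : Λ.Ob} (f : a ⟶ b) (v : {v // T.hom.onOb v = a}) :
    ∃ x : T.graph.Path, x.s = v.1 ∧ T.hom.onPath x = Mor.of f := by
  obtain ⟨v, rfl⟩ := v
  exact (T.bijOn_from v).surjOn (show Mor.of f ∈ Λ.pathsFrom _ from rfl)

/-- The lift of the path `f` that starts in the vertex `v`. -/
noncomputable def lift {a b : Λ.Ob} (f : a ⟶ b) (v : {v // T.hom.onOb v = a}) : T.graph.Path :=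
  (T.exists_lift f v).choose

theorem s_lift {a b : Λ.Ob} (f : a ⟶ b) (v : {v // T.hom.onOb v = a}) : (T.lift f v).s = v.1 :=
  (T.exists_lift f v).choose_spec.1

theorem onPath_lift {a b : Λ.Ob} (f : a ⟶ b) (v : {v // T.hom.onOb v = a}) :
    T.hom.onPath (T.lift f v) = Mor.of f :=
  (T.exists_lift f v).choose_spec.2

theorem onOb_r_lift {a b : Λ.Ob} (f : a ⟶ b) (v : {v // T.hom.onOb v = a}) :
    T.hom.onOb (T.lift f v).r = b :=
  congrArg Mor.r (T.onPath_lift f v)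

theorem eq_lift {a b : Λ.Ob} {f : a ⟶ b} {v : {v // T.hom.onOb v = a}} {x : T.graph.Path}
    (hs : x.s = v.1) (h : T.hom.onPath x = Mor.of f) : x = T.lift f v :=
  (T.bijOn_from v.1).injOn hs (T.s_lift f v) (h.trans (T.onPath_lift f v).symm)

theorem lift_id (v : T.graph.Ob) :
    T.lift (𝟙 (T.hom.onOb v)) ⟨v, rfl⟩ = Mor.of (𝟙 v) :=
  (T.eq_lift (x := Mor.of (𝟙 v)) rfl (T.hom.onPath_id v)).symm

/-- The action of a path on the fibres of a covering, by path lifting. -/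
noncomputable def transport {a b : Λ.Ob} (f : a ⟶ b) (v : {v // T.hom.onOb v = a}) :
    {v // T.hom.onOb v = b} :=
  ⟨(T.lift f v).r, T.onOb_r_lift f v⟩

theorem transport_id {a : Λ.Ob} (v : {v // T.hom.onOb v = a}) : T.transport (𝟙 a) v = v := by
  obtain ⟨v, rfl⟩ := v
  exact Subtype.ext (congrArg Mor.r (T.lift_id v))

theorem transport_comp {a b c : Λ.Ob} (f : a ⟶ b) (g : b ⟶ c) (v : {v // T.hom.onOb v = a}) :
    T.transport (f ≫ g) v = T.transport g (T.transport f v) := by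
  have hs : (T.lift g (T.transport f v)).s = (T.lift f v).r := T.s_lift _ _
  have h₁ := T.s_lift f v
  have h₂ := T.onPath_lift f v
  have h₃ := T.onPath_lift g (T.transport f v)
  refine Subtype.ext ?_
  change (T.lift (f ≫ g) v).r = (T.lift g (T.transport f v)).r
  -- The two lifts compose only after the source of the second is identified with the range of the
  -- first, which needs them as free variables.
  generalize T.lift g (T.transport f v) = y at *
  generalize T.lift f v = x at *
  obtain ⟨x₀, x₁, x⟩ := x
  obtain ⟨y₀, y₁, y⟩ := y
  obtain rfl : y₀ = x₁ := hs
  refine (congrArg Mor.r (T.eq_lift (x := Mor.of (x ≫ y)) h₁ ?_)).symm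
  rw [KHom.onPath_of, Functor.map_comp]
  exact Mor.comp_congr h₂ h₃

/-- Unique lifting from a given range inverts unique lifting from a given source. -/
theorem transport_bijective {a b : Λ.Ob} (f : a ⟶ b) : Function.Bijective (T.transport f) := by
  constructor
  · intro v w h
    have h : (T.lift f v).r = (T.lift f w).r := congrArg Subtype.val h
    have := (T.bijOn_to _).injOn h rfl ((T.onPath_lift f v).trans (T.onPath_lift f w).symm)
    exact Subtype.ext ((T.s_lift f v).symm.trans ((congrArg Mor.s this).trans (T.s_lift f w)))
  · rintro ⟨w, rfl⟩
    obtain ⟨x, rfl, hx⟩ := (T.bijOn_to w).surjOn (show Mor.of f ∈ Λ.pathsTo _ from rfl)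
    refine ⟨⟨x.s, congrArg Mor.s hx⟩, Subtype.ext ?_⟩
    exact (congrArg Mor.r (T.eq_lift (v := ⟨x.s, congrArg Mor.s hx⟩) rfl hx)).symm

/-- The monodromy functor of a covering. -/
noncomputable def fibre : Λ.Ob ⥤ Type u where
  obj a := {v // T.hom.onOb v = a}
  map f := ↾(T.transport f)
  map_id a := by
    refine ConcreteCategory.hom_ext _ _ fun v => ?_
    exact T.transport_id v
  map_comp f g := by
    refine ConcreteCategory.hom_ext _ _ fun v => ?_
    exact T.transport_comp f g v

theorem fibre_isInvertedBy : (⊤ : MorphismProperty Λ.Ob).IsInvertedBy T.fibre :=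
  fun _ _ f _ => (isIso_iff_bijective (T.fibre.map f)).2 (T.transport_bijective f)

end Covering

/-! ### The universal covering -/

/-- The covering of `Λ` whose vertices are the classes of walks that start in `a`. -/
noncomputable def walkCovering (Λ : KGraph.{u} k) (a : Λ.Ob) : Covering Λ :=
  have := walkFunctor_elements_isConnected a
  Λ.elementsCovering (walkFunctor a) fun f => walkFunctor_map_bijective a f

/-- Fix a vertex `v₀` of the given covering above `a`; a class of walks from `a` is sent to the end
of its lift from `v₀`. This is well defined because the monodromy extends to the localisation. -/
theorem walkCovering_isUniversal (Λ : KGraph.{u} k) (a : Λ.Ob) :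
    (walkCovering Λ a).IsUniversal := by
  intro T
  let W : MorphismProperty Λ.Ob := ⊤
  obtain ⟨v₀, hv₀⟩ := T.surjective_onOb a
  let G : W.Localization ⥤ Type u := Localization.Construction.lift T.fibre T.fibre_isInvertedBy
  have hG {b c : Λ.Ob} (f : b ⟶ c) (v : {v // T.hom.onOb v = b}) :
      G.map (W.Q.map f) v = T.transport f v := by
    have h := Functor.congr_hom (Localization.Construction.fac T.fibre T.fibre_isInvertedBy) f
    have h : G.map (W.Q.map f) = 𝟙 _ ≫ T.fibre.map f ≫ 𝟙 _ := h
    rw [h, Category.id_comp, Category.comp_id]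
    rfl
  let o (x : (walkFunctor a).Elements) : {v // T.hom.onOb v = x.1} :=
    G.map x.2 (⟨v₀, hv₀⟩ : {v // T.hom.onOb v = a})
  obtain ⟨φ, hφ, -⟩ := KHom.exists_lift (walkCovering Λ a).hom T.hom
    (fun v => (T.bijOn_from v).injOn) (fun x : (walkFunctor a).Elements => (o x).1) (by
      rintro (x : Mor (walkFunctor a).Elements)
      obtain ⟨⟨b, g⟩, ⟨c, h⟩, ⟨f, hf⟩⟩ := x
      change b ⟶ c at f
      obtain rfl : g ≫ W.Q.map f = h := hf
      refine ⟨T.lift f (o ⟨b, g⟩), T.s_lift _ _, ?_, T.onPath_lift _ _⟩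
      -- Functoriality of `G`: lifting a walk prolonged by `f` means lifting the walk and then `f`.
      have h₁ : o ⟨c, g ≫ W.Q.map f⟩ = T.transport f (o ⟨b, g⟩) := by
        rw [← hG]
        change G.map (g ≫ W.Q.map f) _ = _
        rw [G.map_comp]
        rfl
      exact (congrArg Subtype.val h₁).symm)
  exact ⟨φ, hφ⟩

end RepKG

/-! ### The main theorem -/

theorem corollary3p13 {k : ℕ} (hk : 0 < k) (Λ : RepKG.KGraph.{u} k)
    (C : ConnectedComponents (RepKG.RG Λ)) :
    (∀ X : RepKG.RG Λ, C.objectProperty X →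
      ∃ T : RepKG.Covering X.graph, T.IsUniversal) ∧
    ∀ X : RepKG.RG Λ, C.objectProperty X →
      ∀ T : RepKG.Covering X.graph, T.IsUniversal →
        C.objectProperty (X.ofCovering T).quotientSim ∧
        (X.ofCovering T).quotientSim.Irreducible ∧
        ∀ Y : RepKG.RG Λ, C.objectProperty Y → Y.Irreducible →
          Nonempty (Y ≅ (X.ofCovering T).quotientSim) := by
  refine ⟨fun X _ => ?_, ?_⟩
  · obtain ⟨a⟩ := X.graph.connected.is_nonempty
    exact ⟨_, RepKG.walkCovering_isUniversal X.graph a⟩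
  · rintro X rfl T -
    -- The covering graph maps both to its quotient and to `X`; this span joins the quotient to the
    -- component of `X`.
    have h : Zigzag (X.ofCovering T).quotientSim X :=
      Zigzag.of_inv_hom
        ((X.ofCovering T).quotientHom _ (X.ofCovering T).sim_isAdmissible) (X.ofCoveringHom T)
    refine ⟨Quotient.sound h, (X.ofCovering T).quotientSim_irreducible, fun Y hY hY' => ?_⟩
    have hYX : Zigzag Y X := Quotient.exact hY
    exact hY'.nonempty_iso (X.ofCovering T).quotientSim_irreducible (hYX.trans h.symm)
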